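/- For every $\varepsilon>0$ there exist a time-homogeneous, discrete-time Markov chain on a finite state space $S$ with transition matrix $P$, two states $x,y\in S$ and a positive integer $T$ such that $$\lVert P^T(x,\cdot)-P^T(y,\cdot)\rVert_{\mathrm{TV}}\ \ge\ \tfrac12-\varepsilon,$$ where $\lVert\mu-\nu\rVert_{\mathrm{TV}}=\sup_{A\subseteq S}|\mu(A)-\nu(A)|$, and such that there is a coupling $((X_t,Y_t))_{t=0}^T$ of two copies of the chain with $X_0=x$ and $Y_0=y$ satisfying $$\mathbb{P}\bigl(X_t=Y_t\text{ for some }0\le t\le T\bigr)=1.$$ Here a coupling means a pair of processes $(X_t)_{t=0}^T$, $(Y_t)_{t=0}^T$ on a common probability space, each of which is by itself a Markov chain with transition matrix $P$; the pair need not be Markov. -/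

import Mathlib

open MeasureTheory ProbabilityTheory

/-- The total variation distance `sup_{A ⊆ S} |p(A) - q(A)|` of two distributions on a finite set
`S`, given by their probability mass functions. -/
noncomputable def tvDist {S : Type} [Fintype S] (p q : S → ℝ) : ℝ :=
  ⨆ A : Finset S, |∑ s ∈ A, p s - ∑ s ∈ A, q s|

/-- `(X_t)_{t=0}^T`, defined on the probability space `(Ω, μ)`, is a time-homogeneous Markov chain
on the finite state space `S`, started at `x`, with transition probabilities `P`: whenever a
history `X_0 = h_0, …, X_t = h_t` (`t < T`) has positive probability, the conditional probability
of `X_{t+1} = s` given this history is `P(h_t, s)`. -/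
structure IsMarkovChainFrom {S : Type} {Ω : Type} [MeasurableSpace Ω] {T : ℕ}
    (μ : Measure Ω) (P : Matrix S S ℝ) (x : S) (X : Fin (T + 1) → Ω → S) : Prop where
  measurable : ∀ t s, MeasurableSet {ω | X t ω = s}
  start : ∀ᵐ ω ∂μ, X 0 ω = x
  markov : ∀ (t : Fin T) (h : Fin (T + 1) → S) (s : S),
    μ {ω | ∀ i ≤ t.castSucc, X i ω = h i} ≠ 0 →
      μ[|{ω | ∀ i ≤ t.castSucc, X i ω = h i}] {ω | X t.succ ω = s}
        = ENNReal.ofReal (P (h t.castSucc) s)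

/-- A coupling `((X_t, Y_t))_{t=0}^T` of two copies of the Markov chain with transition
probabilities `P`, started at `x` and `y` respectively: both processes live on one probability
space and each of them, by itself, is a Markov chain with transition probabilities `P`. -/
structure IsCoupling {S : Type} {Ω : Type} [MeasurableSpace Ω] {T : ℕ}
    (μ : Measure Ω) (P : Matrix S S ℝ) (x y : S) (X Y : Fin (T + 1) → Ω → S) : Prop where
  left : IsMarkovChainFrom μ P x X
  right : IsMarkovChainFrom μ P y Y

/-!
The example is a nearest-neighbour walk on the sites `0, …, M + 1` that is much slower at its two
ends than at the inner sites: it spends almost all of its time at the ends and behaves there like a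
two-state chain. It runs for so long that the two-state chain, started at its two states, has total
variation distance close to `1 / 2`.

*Existence of the coupling.* By Hall's theorem (`exists_perm_path_meet`), the trajectories from `x`
and from `y` can be matched so that matched trajectories always meet, provided that `P_x(stay in R)
+ P_y(stay off R) ≤ 1` for every time-dependent set `R` of states. The transition probabilities are
rational, so that trajectories are functions of a uniform point of a finite set and Hall's theorem
applies without weights.

*The survival bound.* Let `R t` contain the end `0` but not the end `M + 1`. There is a site `k t`
with `k t ∉ R t` and `k t - 1 ∈ R t`. The survival function of the walk in `R` vanishes at `k t`, so
that its Dirichlet form is at least its squared value at `0` over `k t`; since nearly all of its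
`L²` norm sits at `0`, the survival probability decays at rate proportional to `1 / k t`
(`energy_survival_le`). By reflection, the survival probability of the walk from `M + 1` off `R`
decays at rate `1 / (M + 2 - k t)`. By the Cauchy–Schwarz inequality `k` may be replaced by its mean
over time, and a tangent line argument shows that the symmetric value `(M + 2) / 2` of the mean is
the worst one (`exp_add_exp_le_one`). For that value each survival probability is about `1 / 2`
precisely when the distance of the two-state chain is about `1 / 2`. If an end changes sides at some
time, then one of the two survival probabilities is negligible (`survival_add_survival_compl_le`
combines the two cases).

*Removing the error.* This bounds the sum by `1 + e` with `e` small. The chain of the theorem starts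
from two additional states, from which it moves to the two ends, with the roles of the ends
exchanged with a probability `δ ≥ e`. Sets `R` that separate the ends then give at most `(1 - δ) *
(1 + e) ≤ 1` (`survival_swapStart_add_le`).

*The total variation distance.* The function that is linear along the sites is an eigenfunction of
the transition operator up to an error that is supported on the inner sites, whose total mass is
small (`le_iterate_transfer_linearProfile`).
-/

/-! ### Chains driven by uniform random maps -/

section Trajectories

variable {S U : Type*}

/-- The trajectory from `i` of the chain that moves from `j` to `φ j u`, when the successive values
of the driving variable `u` are `ω`. -/
def path (φ : S → U → S) {n : ℕ} (i : S) (ω : Fin n → U) : Fin (n + 1) → S :=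
  Fin.induction i fun t s => φ s (ω t)

@[simp] lemma path_zero (φ : S → U → S) {n : ℕ} (i : S) (ω : Fin n → U) : path φ i ω 0 = i := rfl

@[simp] lemma path_succ (φ : S → U → S) {n : ℕ} (i : S) (ω : Fin n → U) (t : Fin n) :
    path φ i ω t.succ = φ (path φ i ω t.castSucc) (ω t) := by
  simp [path]

lemma path_cons_succ (φ : S → U → S) {n : ℕ} (i : S) (u : U) (ω : Fin n → U) (t : Fin (n + 1)) :
    path φ i (Fin.cons u ω : Fin (n + 1) → U) t.succ = path φ (φ i u) ω t := by
  induction t using Fin.induction with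
  | zero =>
    rw [path_succ]
    simp
  | succ t ih => rw [path_succ, ← Fin.succ_castSucc, ih, path_succ, Fin.cons_succ]

lemma path_update_of_le (φ : S → U → S) {n : ℕ} (i : S) (ω : Fin n → U) (t : Fin n)
    (u : U) (j : Fin (n + 1)) (hj : j ≤ t.castSucc) :
    path φ i (Function.update ω t u) j = path φ i ω j := by
  induction j using Fin.induction with
  | zero => simp
  | succ j ih =>
    have hlt : j < t := Nat.lt_of_succ_le (by simpa [Fin.le_def] using hj)
    rw [path_succ, path_succ, ih (by simpa using hlt.le), Function.update_of_ne hlt.ne]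

end Trajectories

section RandomMaps

variable {S S' U : Type*} [Fintype U]

/-- The transition operator `a ↦ 𝔼[a(φ(·, u))]` of the chain that moves from `i` to `φ i u`, the
driving variable `u` being uniform on the finite set `U`. -/
noncomputable def transfer (φ : S → U → S) (a : S → ℝ) (i : S) : ℝ :=
  (∑ u, a (φ i u)) / Fintype.card U

/-- The probability that the chain driven by `φ` stays in the time-dependent set `R` at the times
`0, …, n`, as a function of its starting point. It is defined by conditioning on the first step. -/
noncomputable def survival (φ : S → U → S) : ℕ → (ℕ → Set S) → S → ℝ
  | 0, R => (R 0).indicator 1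
  | n + 1, R => (R 0).indicator (transfer φ (survival φ n fun t => R (t + 1)))

lemma transfer_semiconj {φ : S → U → S} {φ' : S' → U → S'} {f : S' → S}
    (hf : ∀ i u, f (φ' i u) = φ (f i) u) (a : S → ℝ) (i : S') :
    transfer φ a (f i) = transfer φ' (a ∘ f) i := by
  simp [transfer, hf]

lemma iterate_transfer_semiconj {φ : S → U → S} {φ' : S' → U → S'} {f : S' → S}
    (hf : ∀ i u, f (φ' i u) = φ (f i) u) (a : S → ℝ) (n : ℕ) (i : S') :
    (transfer φ)^[n] a (f i) = (transfer φ')^[n] (a ∘ f) i := by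
  induction n generalizing a with
  | zero => rfl
  | succ n ih =>
    rw [Function.iterate_succ_apply, Function.iterate_succ_apply, ih]
    exact congrArg (fun b => (transfer φ')^[n] b i) (funext fun j => transfer_semiconj hf a j)

/-- A map `f` that intertwines two update maps carries survival in `R` to survival in `f ⁻¹' R`. -/
lemma survival_semiconj {φ : S → U → S} {φ' : S' → U → S'} {f : S' → S}
    (hf : ∀ i u, f (φ' i u) = φ (f i) u) (n : ℕ) (R : ℕ → Set S) (i : S') :
    survival φ n R (f i) = survival φ' n (fun t => f ⁻¹' R t) i := by
  induction n generalizing R i with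
  | zero => by_cases hi : f i ∈ R 0 <;> simp [survival, hi]
  | succ n ih =>
    have : survival φ n (fun t => R (t + 1)) ∘ f = survival φ' n fun t => f ⁻¹' R (t + 1) :=
      funext fun j => ih _ j
    by_cases hi : f i ∈ R 0 <;> simp [survival, hi, transfer_semiconj hf, this]

lemma transfer_mono (φ : S → U → S) {a b : S → ℝ} (h : a ≤ b) : transfer φ a ≤ transfer φ b :=
  fun i => div_le_div_of_nonneg_right (Finset.sum_le_sum fun u _ => h (φ i u)) (Nat.cast_nonneg _)

lemma transfer_const [Nonempty U] (φ : S → U → S) (c : ℝ) :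
    transfer φ (fun _ => c) = fun _ => c := by
  ext i
  simp [transfer]

lemma transfer_add (φ : S → U → S) (a b : S → ℝ) :
    transfer φ (a + b) = transfer φ a + transfer φ b := by
  ext i
  simp [transfer, Finset.sum_add_distrib, add_div]

lemma transfer_smul (φ : S → U → S) (c : ℝ) (a : S → ℝ) :
    transfer φ (c • a) = c • transfer φ a := by
  ext i
  simp [transfer, ← Finset.mul_sum, mul_div_assoc]

lemma survival_nonneg (φ : S → U → S) (n : ℕ) (R : ℕ → Set S) : 0 ≤ survival φ n R := by
  induction n generalizing R with
  | zero => exact fun i => Set.indicator_nonneg (by simp) i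
  | succ n ih =>
    refine fun i => Set.indicator_nonneg (fun j _ => ?_) i
    exact div_nonneg (Finset.sum_nonneg fun u _ => ih _ _) (Nat.cast_nonneg _)

lemma survival_le_one [Nonempty U] (φ : S → U → S) (n : ℕ) (R : ℕ → Set S) :
    survival φ n R ≤ 1 := by
  induction n generalizing R with
  | zero => exact fun i => Set.indicator_le_self' (by simp) i
  | succ n ih =>
    refine fun i => Set.indicator_le' (fun j _ => ?_) (by simp) i
    simpa using (transfer_mono φ (ih fun t => R (t + 1)) j).trans_eq
      (congrFun (transfer_const φ 1) j)

lemma survival_eq_zero (φ : S → U → S) (n : ℕ) {R : ℕ → Set S} {i : S} (hi : i ∉ R 0) :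
    survival φ n R i = 0 := by
  cases n <;> simp [survival, hi]

open scoped Classical in
/-- `survival` is the proportion of the driving sequences whose trajectory stays in `R`. -/
lemma card_path_mem (φ : S → U → S) (n : ℕ) (R : ℕ → Set S) (i : S) [Nonempty U] :
    ((Finset.univ.filter fun ω : Fin n → U => ∀ t : Fin (n + 1), path φ i ω t ∈ R t).card : ℝ)
      = survival φ n R i * (Fintype.card U : ℝ) ^ n := by
  induction n generalizing R i with
  | zero =>
    by_cases hi : i ∈ R 0 <;> simp [survival, hi]
  | succ n ih =>
    have hU : (Fintype.card U : ℝ) ≠ 0 := by simp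
    rw [Finset.card_filter, ← (Fin.consEquiv fun _ => U).sum_comp, Fintype.sum_prod_type]
    by_cases hi : i ∈ R 0
    · have key : ∀ u, (∑ ω : Fin n → U,
          if ∀ t : Fin (n + 2), path φ i ((Fin.consEquiv fun _ => U) (u, ω)) t ∈ R t then 1 else 0)
          = (Finset.univ.filter fun ω : Fin n → U =>
              ∀ t : Fin (n + 1), path φ (φ i u) ω t ∈ R (t + 1)).card := by
        intro u
        rw [Finset.card_filter]
        refine Finset.sum_congr rfl fun ω _ => if_congr ?_ rfl rfl
        rw [Fin.forall_fin_succ]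
        simp [-path_succ, Fin.consEquiv, path_cons_succ, hi]
      push_cast [key]
      have := fun u => ih (fun t => R (t + 1)) (φ i u)
      simp only [this, survival, Set.indicator_of_mem hi, transfer, ← Finset.sum_mul]
      field_simp
      ring
    · have : ∀ (u : U) (ω : Fin n → U),
          ¬ ∀ t : Fin (n + 2), path φ i ((Fin.consEquiv fun _ => U) (u, ω)) t ∈ R t :=
        fun u ω h => hi (by simpa using h 0)
      simp [this, survival, hi]

end RandomMaps

/-! ### The driven chain is a Markov chain -/

section MarkovProperty

variable {S U : Type} [DecidableEq S] [Fintype U]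

open scoped Classical in
/-- The Markov property in counting form: given a history up to time `t`, the driving variable of
the next step is still uniform. -/
lemma card_path_eq_and (φ : S → U → S) {n : ℕ} (x : S) (t : Fin n) (h : Fin (n + 1) → S) (s : S) :
    (Finset.univ.filter fun ω : Fin n → U =>
        (∀ i ≤ t.castSucc, path φ x ω i = h i) ∧ path φ x ω t.succ = s).card * Fintype.card U
      = (Finset.univ.filter fun ω : Fin n → U => ∀ i ≤ t.castSucc, path φ x ω i = h i).card
        * (Finset.univ.filter fun u => φ (h t.castSucc) u = s).card := by
  rw [← Finset.card_univ (α := U), ← Finset.card_product, ← Finset.card_product]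
  -- resampling the variable that drives step `t` exchanges it with a fresh one
  refine Finset.card_bij' (fun p _ => (Function.update p.1 t p.2, p.1 t))
    (fun p _ => (Function.update p.1 t p.2, p.1 t)) ?_ ?_ ?_ ?_
  · rintro ⟨ω, u⟩ hp
    simp only [Finset.mem_product, Finset.mem_filter, Finset.mem_univ, true_and, and_true] at hp ⊢
    refine ⟨fun i hi => (path_update_of_le φ x ω t u i hi).trans (hp.1 i hi), ?_⟩
    rw [← hp.1 _ le_rfl, ← path_succ φ x ω t, hp.2]
  · rintro ⟨ω, u⟩ hp
    simp only [Finset.mem_product, Finset.mem_filter, Finset.mem_univ, true_and, and_true] at hp ⊢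
    refine ⟨fun i hi => (path_update_of_le φ x ω t u i hi).trans (hp.1 i hi), ?_⟩
    rw [path_succ, path_update_of_le φ x ω t u _ le_rfl, hp.1 _ le_rfl, Function.update_self, hp.2]
  · rintro ⟨ω, u⟩ -
    simp
  · rintro ⟨ω, u⟩ -
    simp

/-- The transition matrix of the chain driven by `φ`. -/
noncomputable def transitionMatrix (φ : S → U → S) : Matrix S S ℝ :=
  fun i j => transfer φ (({j} : Set S).indicator 1) i

/-- The driven chain is a Markov chain on the uniform space of driving sequences, and remains one
when these are permuted. -/
lemma isMarkovChainFrom_path [Nonempty U] (φ : S → U → S) {n : ℕ} (x : S)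
    (π : Equiv.Perm (Fin n → U)) :
    @IsMarkovChainFrom S (Fin n → U) ⊤ n (@uniformOn _ ⊤ Set.univ) (transitionMatrix φ) x
      fun t ω => path φ x (π ω) t := by
  classical
  let _ : MeasurableSpace (Fin n → U) := ⊤
  have : MeasurableSingletonClass (Fin n → U) := ⟨fun _ => trivial⟩
  refine ⟨fun _ _ => trivial, by simp, fun t h s hE => ?_⟩
  set E : Set (Fin n → U) := {ω | ∀ i ≤ t.castSucc, path φ x (π ω) i = h i} with hEdef
  set A := Finset.univ.filter fun ω : Fin n → U => ∀ i ≤ t.castSucc, path φ x (π ω) i = h i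
  set B := Finset.univ.filter fun ω : Fin n → U => path φ x (π ω) t.succ = s
  have hEA : E = (A : Set (Fin n → U)) := by ext; simp [A, hEdef]
  have hB : {ω | path φ x (π ω) t.succ = s} = (B : Set (Fin n → U)) := by ext; simp [B]
  have hA : A.card = (Finset.univ.filter fun ω : Fin n → U =>
      ∀ i ≤ t.castSucc, path φ x ω i = h i).card :=
    Finset.card_equiv π (by simp [A])
  have hAB : (A ∩ B).card = (Finset.univ.filter fun ω : Fin n → U =>
      (∀ i ≤ t.castSucc, path φ x ω i = h i) ∧ path φ x ω t.succ = s).card :=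
    Finset.card_equiv π (by simp [A, B])
  have hA0 : A.card ≠ 0 := by
    intro h0
    rw [Finset.card_eq_zero] at h0
    exact hE (by rw [hEA, h0]; simp)
  have hid := card_path_eq_and φ x t h s
  rw [← hA, ← hAB] at hid
  have hU : (Fintype.card U : ℝ) ≠ 0 := by simp
  have hP : transitionMatrix φ (h t.castSucc) s = ((A ∩ B).card : ℝ) / A.card := by
    have : transitionMatrix φ (h t.castSucc) s
        = ((Finset.univ.filter fun u => φ (h t.castSucc) u = s).card : ℝ) / Fintype.card U := by
      simp [transitionMatrix, transfer, Set.indicator_apply]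
    rw [this, div_eq_div_iff hU (by exact_mod_cast hA0), mul_comm]
    exact_mod_cast hid.symm
  rw [uniformOn, cond_cond_eq_cond_inter' .univ (show MeasurableSet E from trivial) (by simp),
    Set.univ_inter, hEA, hB,
    ← uniformOn, uniformOn_apply_finset, hP,
    ENNReal.ofReal_div_of_pos (by positivity), ENNReal.ofReal_natCast, ENNReal.ofReal_natCast]

end MarkovProperty

section FiniteStateSpace

variable {S U : Type} [Fintype S] [DecidableEq S] [Fintype U]

lemma transitionMatrix_mulVec (φ : S → U → S) (a : S → ℝ) :
    (transitionMatrix φ).mulVec a = transfer φ a := by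
  ext i
  simp only [Matrix.mulVec, dotProduct, transitionMatrix, transfer, div_mul_eq_mul_div,
    ← Finset.sum_div, Finset.sum_mul]
  rw [Finset.sum_comm]
  simp [Set.indicator_apply]

lemma transitionMatrix_pow_mulVec (φ : S → U → S) (a : S → ℝ) (n : ℕ) :
    (transitionMatrix φ ^ n).mulVec a = (transfer φ)^[n] a := by
  induction n with
  | zero => simp
  | succ n ih =>
    rw [pow_succ', ← Matrix.mulVec_mulVec, ih, transitionMatrix_mulVec,
      Function.iterate_succ_apply']

lemma transitionMatrix_mem_rowStochastic [Nonempty U] (φ : S → U → S) :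
    transitionMatrix φ ∈ Matrix.rowStochastic ℝ S := by
  rw [Matrix.mem_rowStochastic]
  constructor
  · intro i j
    exact div_nonneg (Finset.sum_nonneg fun u _ => Set.indicator_nonneg (by simp) _)
      (Nat.cast_nonneg _)
  · rw [transitionMatrix_mulVec]
    exact transfer_const φ 1

end FiniteStateSpace

lemma sum_sub_sum_le_tvDist {S : Type} [Fintype S] {p q : S → ℝ}
    (hpq : ∑ s, p s = ∑ s, q s) {g : S → ℝ} (hg : ∀ s, |g s| ≤ 1 / 2) :
    ∑ s, p s * g s - ∑ s, q s * g s ≤ tvDist p q := by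
  have h1 : ∑ s, p s * g s - ∑ s, q s * g s = ∑ s, (p s - q s) * (g s + 1 / 2) := by
    simp only [mul_add, sub_mul, Finset.sum_add_distrib, Finset.sum_sub_distrib, ← Finset.sum_mul,
      hpq]
    ring
  have h2 : ∑ s, (p s - q s) * (g s + 1 / 2)
      ≤ ∑ s ∈ Finset.univ.filter fun s => q s ≤ p s, (p s - q s) := by
    rw [Finset.sum_filter]
    refine Finset.sum_le_sum fun s _ => ?_
    have := abs_le.1 (hg s)
    split_ifs with h
    · nlinarith
    · nlinarith
  have h3 : ∑ s ∈ Finset.univ.filter (fun s => q s ≤ p s), (p s - q s)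
      ≤ |∑ s ∈ Finset.univ.filter (fun s => q s ≤ p s), p s
        - ∑ s ∈ Finset.univ.filter (fun s => q s ≤ p s), q s| := by
    rw [Finset.sum_sub_distrib]
    exact le_abs_self _
  rw [h1]
  refine (h2.trans h3).trans ?_
  exact le_ciSup (f := fun A : Finset S => |∑ s ∈ A, p s - ∑ s ∈ A, q s|)
    (Set.finite_range _).bddAbove _

/-! ### Meeting couplings from Hall's theorem -/

section Hall

variable {S U : Type*} [Fintype U] [Nonempty U]

/-- If, for every time-dependent set `R`, the probability that the chain from `x` stays in `R` and
the probability that the chain from `y` stays off `R` add up to at most one, then the trajectories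
from `x` and from `y` can be matched in such a way that matched trajectories always meet. -/
theorem exists_perm_path_meet (φ : S → U → S) (n : ℕ) (x y : S)
    (h : ∀ R : ℕ → Set S, survival φ n R x + survival φ n (fun t => (R t)ᶜ) y ≤ 1) :
    ∃ π : Equiv.Perm (Fin n → U), ∀ ω, ∃ t, path φ x ω t = path φ y (π ω) t := by
  classical
  obtain ⟨f, hf, hmeet⟩ := (Fintype.all_card_le_filter_rel_iff_exists_injective
    (fun ω ω' : Fin n → U => ∃ t, path φ x ω t = path φ y ω' t)).1 fun A => by
      -- `R t` collects the positions at time `t` of the trajectories in `A`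
      let R : ℕ → Set S := fun k => {s | ∃ ω ∈ A, ∃ t : Fin (n + 1), (t : ℕ) = k ∧ path φ x ω t = s}
      have h1 : A ⊆ Finset.univ.filter fun ω => ∀ t : Fin (n + 1), path φ x ω t ∈ R t := by
        intro ω hω
        simp only [Finset.mem_filter, Finset.mem_univ, true_and]
        exact fun t => ⟨ω, hω, t, rfl, rfl⟩
      have h2 : (Finset.univ.filter fun ω' => ∃ ω ∈ A, ∃ t, path φ x ω t = path φ y ω' t)ᶜ
          ⊆ Finset.univ.filter fun ω' => ∀ t : Fin (n + 1), path φ y ω' t ∈ (R t)ᶜ := by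
        intro ω' hω'
        simp only [Finset.mem_compl, Finset.mem_filter, Finset.mem_univ, true_and] at hω' ⊢
        rintro t ⟨ω, hω, t', ht', he⟩
        obtain rfl := Fin.ext ht'
        exact hω' ⟨ω, hω, t', he⟩
      have h3 : ((Finset.univ.filter fun ω => ∀ t : Fin (n + 1), path φ x ω t ∈ R t).card : ℝ)
          + (Finset.univ.filter fun ω' => ∀ t : Fin (n + 1), path φ y ω' t ∈ (R t)ᶜ).card
          ≤ Fintype.card (Fin n → U) := by
        have e1 : ((Finset.univ.filter fun ω => ∀ t : Fin (n + 1), path φ x ω t ∈ R t).card : ℝ)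
            = survival φ n R x * (Fintype.card U : ℝ) ^ n := by
          convert card_path_mem φ n R x
        have e2 : ((Finset.univ.filter fun ω' =>
            ∀ t : Fin (n + 1), path φ y ω' t ∈ (R t)ᶜ).card : ℝ)
            = survival φ n (fun t => (R t)ᶜ) y * (Fintype.card U : ℝ) ^ n := by
          convert card_path_mem φ n (fun t => (R t)ᶜ) y
        rw [e1, e2, ← add_mul]
        simpa using mul_le_mul_of_nonneg_right (h R)
          (by positivity : (0 : ℝ) ≤ (Fintype.card U : ℝ) ^ n)
      have h4 := Finset.card_le_card h2
      rw [Finset.card_compl] at h4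
      have h5 := Finset.card_le_card h1
      norm_cast at h3
      have h6 := Finset.card_le_univ
        (Finset.univ.filter fun ω' => ∃ ω ∈ A, ∃ t, path φ x ω t = path φ y ω' t)
      omega
  exact ⟨Equiv.ofBijective f (Finite.injective_iff_bijective.1 hf), hmeet⟩

end Hall

/-! ### Chains started with a swap -/

section Swap

variable {S U : Type*} [Fintype U]

/-- The chain driven by `φ`, with two additional states. From `inr true` the chain moves to `x`,
except that it moves to `y` when the driving variable lies in `D`; from `inr false` it moves to
`y`, except that it moves to `x` when the driving variable lies in `D`. -/
def swapStart (φ : S → U → S) (x y : S) (D : U → Bool) : S ⊕ Bool → U → S ⊕ Bool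
  | Sum.inl i, u => Sum.inl (φ i u)
  | Sum.inr b, u => Sum.inl (if xor b (D u) then x else y)

/-- The proportion of driving variables that lie in `D`. -/
noncomputable def swapProb (D : U → Bool) : ℝ := (∑ u, if D u then 1 else 0) / Fintype.card U

variable (φ : S → U → S) (x y : S) (D : U → Bool)

variable [Nonempty U]

lemma transfer_swapStart_true (a : S ⊕ Bool → ℝ) :
    transfer (swapStart φ x y D) a (Sum.inr true)
      = (1 - swapProb D) * a (Sum.inl x) + swapProb D * a (Sum.inl y) := by
  have hU : (Fintype.card U : ℝ) ≠ 0 := by simp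
  have : ∀ u, a (swapStart φ x y D (Sum.inr true) u)
      = a (Sum.inl x) + (if D u then 1 else 0) * (a (Sum.inl y) - a (Sum.inl x)) := by
    intro u
    cases h : D u <;> simp [swapStart, h]
  simp only [transfer, this, swapProb, Finset.sum_add_distrib, ← Finset.sum_mul]
  simp only [Finset.sum_const, Finset.card_univ, nsmul_eq_mul]
  field_simp
  ring

lemma transfer_swapStart_false (a : S ⊕ Bool → ℝ) :
    transfer (swapStart φ x y D) a (Sum.inr false)
      = (1 - swapProb D) * a (Sum.inl y) + swapProb D * a (Sum.inl x) := by
  have hU : (Fintype.card U : ℝ) ≠ 0 := by simp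
  have : ∀ u, a (swapStart φ x y D (Sum.inr false) u)
      = a (Sum.inl y) + (if D u then 1 else 0) * (a (Sum.inl x) - a (Sum.inl y)) := by
    intro u
    cases h : D u <;> simp [swapStart, h]
  simp only [transfer, this, swapProb, Finset.sum_add_distrib, ← Finset.sum_mul]
  simp only [Finset.sum_const, Finset.card_univ, nsmul_eq_mul]
  field_simp
  ring

/-- If the survival probabilities from `x` in `R` and from `y` off `R` add up to at most `1 + e`
whenever `R` separates `x` from `y`, then after a swap of probability at least `e` they add up to
at most one. -/
lemma survival_swapStart_add_le {e : ℝ} (he : e ≤ swapProb D) (hD : swapProb D ≤ 1 / 2) {n : ℕ}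
    (h : ∀ R : ℕ → Set S, x ∈ R 0 → y ∉ R 0 →
      survival φ n R x + survival φ n (fun t => (R t)ᶜ) y ≤ 1 + e) (R : ℕ → Set (S ⊕ Bool)) :
    survival (swapStart φ x y D) (n + 1) R (Sum.inr true)
      + survival (swapStart φ x y D) (n + 1) (fun t => (R t)ᶜ) (Sum.inr false) ≤ 1 := by
  set δ := swapProb D
  have hδ : 0 ≤ δ := div_nonneg (Finset.sum_nonneg fun u _ => by split_ifs <;> simp)
    (Nat.cast_nonneg _)
  set Q : ℕ → Set S := fun t => Sum.inl ⁻¹' R (t + 1)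
  have hQ : ∀ i, survival (swapStart φ x y D) n (fun t => R (t + 1)) (Sum.inl i)
      = survival φ n Q i := survival_semiconj (fun _ _ => rfl) _ _
  have hQc : ∀ i, survival (swapStart φ x y D) n (fun t => (R (t + 1))ᶜ) (Sum.inl i)
      = survival φ n (fun t => (Q t)ᶜ) i := survival_semiconj (fun _ _ => rfl) _ _
  have h1 : survival (swapStart φ x y D) (n + 1) R (Sum.inr true)
      ≤ (1 - δ) * survival φ n Q x + δ * survival φ n Q y := by
    rw [← hQ, ← hQ, ← transfer_swapStart_true]
    exact Set.indicator_le_self' (fun _ _ => by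
      exact div_nonneg (Finset.sum_nonneg fun u _ => survival_nonneg _ _ _ _) (Nat.cast_nonneg _)) _
  have h2 : survival (swapStart φ x y D) (n + 1) (fun t => (R t)ᶜ) (Sum.inr false)
      ≤ (1 - δ) * survival φ n (fun t => (Q t)ᶜ) y + δ * survival φ n (fun t => (Q t)ᶜ) x := by
    rw [← hQc, ← hQc, ← transfer_swapStart_false]
    exact Set.indicator_le_self' (fun _ _ => by
      exact div_nonneg (Finset.sum_nonneg fun u _ => survival_nonneg _ _ _ _) (Nat.cast_nonneg _)) _
  refine (add_le_add h1 h2).trans ?_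
  have ex := survival_le_one φ n Q x
  have ey := survival_le_one φ n Q y
  have ex' := survival_le_one φ n (fun t => (Q t)ᶜ) x
  have ey' := survival_le_one φ n (fun t => (Q t)ᶜ) y
  simp only [Pi.one_apply] at ex ey ex' ey'
  by_cases hx : x ∈ Q 0 <;> by_cases hy : y ∈ Q 0
  · rw [survival_eq_zero φ n (R := fun t => (Q t)ᶜ) (i := x) (by simpa using hx),
      survival_eq_zero φ n (R := fun t => (Q t)ᶜ) (i := y) (by simpa using hy)]
    nlinarith
  · rw [survival_eq_zero φ n (R := fun t => (Q t)ᶜ) (i := x) (by simpa using hx),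
      survival_eq_zero φ n (i := y) hy]
    have := h Q hx hy
    nlinarith
  · rw [survival_eq_zero φ n (R := fun t => (Q t)ᶜ) (i := y) (by simpa using hy),
      survival_eq_zero φ n (i := x) hx]
    nlinarith
  · rw [survival_eq_zero φ n (i := y) hy, survival_eq_zero φ n (i := x) hx]
    nlinarith

end Swap

/-- A chain driven by random maps yields a coupling that meets almost surely, and a total variation
distance close to that of two of its states, provided that the survival probabilities from these
states in complementary time-dependent sets add up to at most `1 + e`. -/
theorem exists_coupling_of_survival {S U : Type} [Fintype S] [DecidableEq S] [Fintype U]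
    [Nonempty U] (φ : S → U → S) (x y : S) (D : U → Bool) {e : ℝ} (he : e ≤ swapProb D)
    (hD : swapProb D ≤ 1 / 2) {n : ℕ}
    (h : ∀ R : ℕ → Set S, x ∈ R 0 → y ∉ R 0 →
      survival φ n R x + survival φ n (fun t => (R t)ᶜ) y ≤ 1 + e)
    (g : S → ℝ) (hg : ∀ s, |g s| ≤ 1 / 2) {v : ℝ}
    (hv : v ≤ (1 - 2 * swapProb D) * ((transfer φ)^[n] g x - (transfer φ)^[n] g y)) :
    ∃ (S : Type) (_ : Fintype S) (_ : DecidableEq S) (P : Matrix S S ℝ) (x y : S) (T : ℕ),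
      P ∈ Matrix.rowStochastic ℝ S ∧ 0 < T ∧
      v ≤ tvDist ((P ^ T) x) ((P ^ T) y) ∧
      ∃ (Ω : Type) (_ : MeasurableSpace Ω) (μ : Measure Ω) (X Y : Fin (T + 1) → Ω → S),
        IsProbabilityMeasure μ ∧ IsCoupling μ P x y X Y ∧
        μ {ω | ∃ t, X t ω = Y t ω} = 1 := by
  obtain ⟨π, hπ⟩ := exists_perm_path_meet (swapStart φ x y D) (n + 1) _ _
    (survival_swapStart_add_le φ x y D he hD h)
  refine ⟨S ⊕ Bool, inferInstance, inferInstance, transitionMatrix (swapStart φ x y D),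
    Sum.inr true, Sum.inr false, n + 1, transitionMatrix_mem_rowStochastic _, n.succ_pos, ?_,
    Fin (n + 1) → U, ⊤, @uniformOn _ ⊤ Set.univ,
    fun t ω => path (swapStart φ x y D) (Sum.inr true) ω t,
    fun t ω => path (swapStart φ x y D) (Sum.inr false) (π ω) t, ?_,
    ?_, ?_⟩
  · set G : S ⊕ Bool → ℝ := Sum.elim g fun _ => 0
    have hG : ∀ s, |G s| ≤ 1 / 2 := by
      rintro (s | b)
      · exact hg s
      · simp [G]
    have hst : transitionMatrix (swapStart φ x y D) ^ (n + 1) ∈ Matrix.rowStochastic ℝ (S ⊕ Bool) :=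
      pow_mem (transitionMatrix_mem_rowStochastic _) _
    have hsum := Matrix.sum_row_of_mem_rowStochastic hst
    refine le_trans ?_ (sum_sub_sum_le_tvDist ((hsum _).trans (hsum _).symm) hG)
    have hpow := congrFun (transitionMatrix_pow_mulVec (swapStart φ x y D) G (n + 1))
    simp only [Matrix.mulVec, dotProduct] at hpow
    have hinl : ∀ i u, Sum.inl (φ i u) = swapStart φ x y D (Sum.inl i) u := fun _ _ => rfl
    rw [hpow, hpow, Function.iterate_succ_apply', transfer_swapStart_true,
      transfer_swapStart_false, iterate_transfer_semiconj hinl, iterate_transfer_semiconj hinl,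
      show G ∘ Sum.inl = g from rfl]
    linarith
  · let _ : MeasurableSpace (Fin (n + 1) → U) := ⊤
    have : MeasurableSingletonClass (Fin (n + 1) → U) := ⟨fun _ => trivial⟩
    infer_instance
  · exact @IsCoupling.mk _ _ ⊤ _ _ _ _ _ _ _ (isMarkovChainFrom_path _ _ (Equiv.refl _))
      (isMarkovChainFrom_path _ _ π)
  · let _ : MeasurableSpace (Fin (n + 1) → U) := ⊤
    have : MeasurableSingletonClass (Fin (n + 1) → U) := ⟨fun _ => trivial⟩
    have : {ω : Fin (n + 1) → U | ∃ t, path (swapStart φ x y D) (Sum.inr true) ω t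
        = path (swapStart φ x y D) (Sum.inr false) (π ω) t} = Set.univ :=
      Set.eq_univ_of_forall hπ
    rw [this]
    exact measure_univ

/-! ### Energy decay for a walk with slow ends -/

section Walk

/-- The transition operator of the nearest-neighbour walk on the sites `0, …, M + 1` that leaves
an end with probability `1 / N` and moves from an inner site to each of its two neighbours with
probability `q / N`. Sites beyond `M + 1` are identified with `M + 1`. -/
noncomputable def walkOp (M : ℕ) (q N : ℝ) (a : ℕ → ℝ) (i : ℕ) : ℝ :=
  if i = 0 then a 0 + (a 1 - a 0) / N
  else if M + 1 ≤ i then a (M + 1) + (a M - a (M + 1)) / N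
  else a i + q / N * ((a (i - 1) - a i) + (a (i + 1) - a i))

/-- The squared `L²` norm with respect to the reversible measure of the walk, which gives mass `1`
to each end and mass `1 / q` to each inner site. -/
noncomputable def energy (M : ℕ) (q : ℝ) (a : ℕ → ℝ) : ℝ :=
  a 0 ^ 2 + a (M + 1) ^ 2 + (∑ i ∈ Finset.range M, a (i + 1) ^ 2) / q

/-- The sum of the squared increments along the sites `0, …, M + 1`. -/
def sqIncrements (M : ℕ) (a : ℕ → ℝ) : ℝ :=
  ∑ i ∈ Finset.range (M + 1), (a (i + 1) - a i) ^ 2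

variable {M : ℕ} {q N : ℝ}

lemma sqIncrements_nonneg (a : ℕ → ℝ) : 0 ≤ sqIncrements M a :=
  Finset.sum_nonneg fun _ _ => sq_nonneg _

lemma energy_mono (hq : 0 ≤ q) {a b : ℕ → ℝ} (h : ∀ i, |a i| ≤ |b i|) :
    energy M q a ≤ energy M q b := by
  have h' : ∀ i, a i ^ 2 ≤ b i ^ 2 := fun i => sq_le_sq.2 (h i)
  exact add_le_add (add_le_add (h' _) (h' _))
    (div_le_div_of_nonneg_right (Finset.sum_le_sum fun i _ => h' _) hq)

lemma sq_le_energy (hq : 0 ≤ q) (a : ℕ → ℝ) : a 0 ^ 2 ≤ energy M q a := by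
  have : 0 ≤ (∑ i ∈ Finset.range M, a (i + 1) ^ 2) / q :=
    div_nonneg (Finset.sum_nonneg fun i _ => sq_nonneg _) hq
  have := sq_nonneg (a (M + 1))
  unfold energy
  linarith

lemma sq_end_le_energy (hq : 0 ≤ q) (a : ℕ → ℝ) : a (M + 1) ^ 2 ≤ energy M q a := by
  have : 0 ≤ (∑ i ∈ Finset.range M, a (i + 1) ^ 2) / q :=
    div_nonneg (Finset.sum_nonneg fun i _ => sq_nonneg _) hq
  have := sq_nonneg (a 0)
  unfold energy
  linarith

lemma energy_le (hq : 0 ≤ q) {a : ℕ → ℝ} (ha : ∀ i, |a i| ≤ 1) :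
    energy M q a ≤ a 0 ^ 2 + a (M + 1) ^ 2 + M / q := by
  have : ∑ i ∈ Finset.range M, a (i + 1) ^ 2 ≤ M := by
    refine (Finset.sum_le_card_nsmul _ _ 1 fun i _ => ?_).trans_eq (by simp)
    simpa using sq_le_sq.2 ((ha (i + 1)).trans_eq abs_one.symm)
  unfold energy
  gcongr

/-- Summation by parts. -/
lemma sum_mul_second_difference (M : ℕ) (a : ℕ → ℝ) :
    a 0 * (a 1 - a 0) + a (M + 1) * (a M - a (M + 1))
        + ∑ i ∈ Finset.range M, a (i + 1) * ((a i - a (i + 1)) + (a (i + 2) - a (i + 1)))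
      = - sqIncrements M a := by
  induction M with
  | zero => simp [sqIncrements]; ring
  | succ M ih =>
    have : sqIncrements (M + 1) a = sqIncrements M a + (a (M + 2) - a (M + 1)) ^ 2 :=
      Finset.sum_range_succ _ _
    rw [Finset.sum_range_succ, this, neg_add, ← ih]
    ring

lemma sum_sq_second_difference_le (M : ℕ) (a : ℕ → ℝ) :
    (a 1 - a 0) ^ 2 + (a M - a (M + 1)) ^ 2
        + (∑ i ∈ Finset.range M, ((a i - a (i + 1)) + (a (i + 2) - a (i + 1))) ^ 2) / 2
      ≤ 2 * sqIncrements M a := by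
  have h1 : sqIncrements M a
      = ∑ i ∈ Finset.range M, (a (i + 1) - a i) ^ 2 + (a (M + 1) - a M) ^ 2 :=
    Finset.sum_range_succ _ _
  have h2 : sqIncrements M a
      = ∑ i ∈ Finset.range M, (a (i + 2) - a (i + 1)) ^ 2 + (a 1 - a 0) ^ 2 :=
    Finset.sum_range_succ' _ _
  have h3 : (∑ i ∈ Finset.range M, ((a i - a (i + 1)) + (a (i + 2) - a (i + 1))) ^ 2) / 2
      ≤ ∑ i ∈ Finset.range M, (a (i + 1) - a i) ^ 2
        + ∑ i ∈ Finset.range M, (a (i + 2) - a (i + 1)) ^ 2 := by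
    rw [← Finset.sum_add_distrib, Finset.sum_div]
    refine Finset.sum_le_sum fun i _ => ?_
    nlinarith [sq_nonneg ((a i - a (i + 1)) - (a (i + 2) - a (i + 1)))]
  nlinarith

/-- Each step of the walk dissipates energy, at a rate given by the squared increments: the term
`2 / N` is the Dirichlet form, and `4 * q / N ^ 2` bounds the second-order correction. -/
lemma energy_walkOp_le (hq : 1 ≤ q) (hN : 0 < N) (a : ℕ → ℝ) :
    energy M q (walkOp M q N a) ≤ energy M q a - (2 - 4 * q / N) / N * sqIncrements M a := by
  have h0 : walkOp M q N a 0 = a 0 + (a 1 - a 0) / N := by simp [walkOp]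
  have hm : walkOp M q N a (M + 1) = a (M + 1) + (a M - a (M + 1)) / N := by simp [walkOp]
  have hi : ∀ i ∈ Finset.range M, walkOp M q N a (i + 1) ^ 2
      = a (i + 1) ^ 2 + (2 * q / N) * (a (i + 1) * ((a i - a (i + 1)) + (a (i + 2) - a (i + 1))))
        + q ^ 2 / N ^ 2 * ((a i - a (i + 1)) + (a (i + 2) - a (i + 1))) ^ 2 := by
    intro i hi
    have hi : ¬ M ≤ i := by simpa using hi
    simp only [walkOp, Nat.add_eq_zero_iff, one_ne_zero, and_false, if_false,
      add_le_add_iff_right, hi, Nat.add_sub_cancel]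
    ring
  have hq0 : q ≠ 0 := by positivity
  set A := ∑ i ∈ Finset.range M, a (i + 1) * ((a i - a (i + 1)) + (a (i + 2) - a (i + 1))) with hA
  set B := ∑ i ∈ Finset.range M, ((a i - a (i + 1)) + (a (i + 2) - a (i + 1))) ^ 2 with hB
  have hsum : (∑ i ∈ Finset.range M, walkOp M q N a (i + 1) ^ 2) / q
      = (∑ i ∈ Finset.range M, a (i + 1) ^ 2) / q + 2 / N * A + q / N ^ 2 * B := by
    rw [Finset.sum_congr rfl hi, Finset.sum_add_distrib, Finset.sum_add_distrib,
      ← Finset.mul_sum, ← Finset.mul_sum, ← hA, ← hB]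
    field_simp
  have h1 := sum_mul_second_difference M a
  have h2 := sum_sq_second_difference_le M a
  rw [← hA] at h1
  rw [← hB] at h2
  have hB0 : 0 ≤ B := Finset.sum_nonneg fun _ _ => sq_nonneg _
  have key : energy M q (walkOp M q N a) = energy M q a - 2 / N * sqIncrements M a
      + ((a 1 - a 0) ^ 2 + (a M - a (M + 1)) ^ 2 + q * B) / N ^ 2 := by
    have hA' : A = - sqIncrements M a - a 0 * (a 1 - a 0) - a (M + 1) * (a M - a (M + 1)) := by
      linarith
    unfold energy
    rw [h0, hm, hsum, hA']
    field_simp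
    ring
  have h3 : (a 1 - a 0) ^ 2 + (a M - a (M + 1)) ^ 2 + q * B ≤ 4 * q * sqIncrements M a := by
    nlinarith [sq_nonneg (a 1 - a 0), sq_nonneg (a M - a (M + 1))]
  have h4 : ((a 1 - a 0) ^ 2 + (a M - a (M + 1)) ^ 2 + q * B) / N ^ 2
      ≤ 4 * q * sqIncrements M a / N ^ 2 := by gcongr
  have h5 : (2 - 4 * q / N) / N * sqIncrements M a
      = 2 / N * sqIncrements M a - 4 * q * sqIncrements M a / N ^ 2 := by
    field_simp
  rw [key, h5]
  linarith

lemma energy_walkOp_le_self (hq : 1 ≤ q) (hN : 2 * q ≤ N) (a : ℕ → ℝ) :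
    energy M q (walkOp M q N a) ≤ energy M q a := by
  have hN0 : 0 < N := by linarith
  refine (energy_walkOp_le hq hN0 a).trans (sub_le_self _ ?_)
  have : 4 * q / N ≤ 2 := by rw [div_le_iff₀ hN0]; linarith
  exact mul_nonneg (div_nonneg (by linarith) hN0.le) (sqIncrements_nonneg a)

/-- A function that vanishes at the site `k` has increments of total size at least its value at
`0`, spread over `k` edges. -/
lemma sq_le_mul_sqIncrements {a : ℕ → ℝ} {k : ℕ} (hk : k ≤ M + 1) (ha : a k = 0) :
    a 0 ^ 2 ≤ k * sqIncrements M a := by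
  have h1 : a 0 ^ 2 = (∑ i ∈ Finset.range k, (a (i + 1) - a i)) ^ 2 := by
    rw [Finset.sum_range_sub, ha]
    ring
  rw [h1]
  refine sq_sum_le_card_mul_sum_sq.trans ?_
  rw [Finset.card_range]
  gcongr
  exact Finset.sum_le_sum_of_subset_of_nonneg (by simpa using hk) fun _ _ _ => sq_nonneg _

/-- If `a` vanishes at the far end and at the site `k`, then the part of its energy that exceeds
the mass `M / q` of the inner sites decays by the factor `exp (-c / k)` in one step. -/
lemma energy_walkOp_le_exp (hq : 1 ≤ q) (hN : 2 * q ≤ N) {a : ℕ → ℝ} (ha : ∀ i, |a i| ≤ 1)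
    (hend : a (M + 1) = 0) {k : ℕ} (hk : k ≤ M + 1) (hk0 : 0 < k) (hak : a k = 0)
    {x : ℝ} (hx : energy M q a ≤ M / q + Real.exp x) :
    energy M q (walkOp M q N a) ≤ M / q + Real.exp (x - (2 - 4 * q / N) / N * (1 / k)) := by
  have hN0 : 0 < N := by linarith
  rcases le_total (energy M q a) (M / q) with h | h
  · exact (energy_walkOp_le_self hq hN a).trans
      (h.trans (le_add_of_nonneg_right (Real.exp_nonneg _)))
  set c := (2 - 4 * q / N) / N
  have hc : 0 ≤ c := by
    have : 4 * q / N ≤ 2 := by rw [div_le_iff₀ hN0]; linarith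
    exact div_nonneg (by linarith) hN0.le
  have hkr : (0 : ℝ) < k := by exact_mod_cast hk0
  have h1 : energy M q a - M / q ≤ a 0 ^ 2 := by
    have := energy_le (M := M) (by linarith : 0 ≤ q) ha
    rw [hend] at this
    linarith
  have h2 : (energy M q a - M / q) * (1 / k) ≤ sqIncrements M a := by
    rw [mul_one_div, div_le_iff₀ hkr, mul_comm]
    exact h1.trans (sq_le_mul_sqIncrements hk hak)
  have h3 := energy_walkOp_le (M := M) hq hN0 a
  have h4 : c * ((energy M q a - M / q) * (1 / k)) ≤ c * sqIncrements M a := by gcongr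
  have h5 : (energy M q a - M / q) * (1 - c * (1 / k)) ≤ Real.exp x * Real.exp (-(c * (1 / k))) :=
    (mul_le_mul_of_nonneg_left (by linarith [Real.add_one_le_exp (-(c * (1 / k)))])
      (by linarith)).trans (mul_le_mul_of_nonneg_right (by linarith) (Real.exp_nonneg _))
  rw [← Real.exp_add, ← sub_eq_add_neg] at h5
  linarith

end Walk

/-! ### Survival of the walk in moving sets -/

/-- The tangent line at `1 / 2` lies above `σ ↦ 2 ^ (-1 / (2σ))`. -/
lemma exp_neg_div_le {τ σ : ℝ} (hσ : 0 < σ) (hτ : Real.log 2 / 2 ≤ τ) :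
    Real.exp (-(τ / σ)) ≤ 1 / 2 + Real.log 2 * (σ - 1 / 2) := by
  set l := Real.log 2
  have hl0 : 0 < l := Real.log_pos one_lt_two
  have hl1 : l < 1 := by have := Real.log_two_lt_d9; linarith
  set w := 1 / (2 * σ) with hw
  have hw0 : 0 < w := by positivity
  have hσw : σ = 1 / (2 * w) := by rw [hw]; field_simp
  have h1 : Real.exp (-(τ / σ)) ≤ 1 / 2 * (Real.exp (l * (w - 1)))⁻¹ := by
    have h2 : (1 / 2 : ℝ) = Real.exp (-l) := by
      rw [Real.exp_neg, Real.exp_log two_pos]; norm_num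
    rw [h2, ← Real.exp_neg, ← Real.exp_add, Real.exp_le_exp]
    have : l / 2 / σ ≤ τ / σ := by gcongr
    have h3 : l / 2 / σ = l * w := by rw [hw]; field_simp
    linarith
  have h2 : 0 < 1 + l * (w - 1) := by nlinarith
  have h3 : (Real.exp (l * (w - 1)))⁻¹ ≤ (1 + l * (w - 1))⁻¹ :=
    inv_anti₀ h2 (by linarith [Real.add_one_le_exp (l * (w - 1))])
  have h4 : (1 + l * (w - 1))⁻¹ ≤ 1 - l * ((w - 1) / w) := by
    rw [inv_le_iff_one_le_mul₀' h2]
    have : (1 + l * (w - 1)) * (1 - l * ((w - 1) / w)) = 1 + l * (1 - l) * (w - 1) ^ 2 / w := by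
      field_simp
      ring
    rw [this]
    have : 0 ≤ l * (1 - l) * (w - 1) ^ 2 / w :=
      div_nonneg (mul_nonneg (mul_nonneg hl0.le (by linarith)) (sq_nonneg _)) hw0.le
    linarith
  have h5 : 1 / 2 + l * (σ - 1 / 2) = 1 / 2 * (1 - l * ((w - 1) / w)) := by
    rw [hσw]
    field_simp
    ring
  rw [h5]
  linarith

/-- Two competing survival probabilities with rates `1 / k t` and `1 / l t`, where `k t + l t` is
constant, add up to at most one if the constant choice `k t = l t` makes each at most `1 / 2`. -/
lemma exp_add_exp_le_one {c : ℝ} (hc : 0 ≤ c) {n M : ℕ} (k l : ℕ → ℕ)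
    (hkl : ∀ t < n, 0 < k t ∧ 0 < l t ∧ k t + l t = M + 2)
    (hn : Real.log 2 ≤ c * n / (M + 2)) :
    Real.exp (-(c / 2 * ∑ t ∈ Finset.range n, 1 / (k t : ℝ)))
      + Real.exp (-(c / 2 * ∑ t ∈ Finset.range n, 1 / (l t : ℝ))) ≤ 1 := by
  have hn0 : n ≠ 0 := by
    rintro rfl
    have := Real.log_pos one_lt_two
    simp at hn
    linarith
  have hnr : (0 : ℝ) < n := by positivity
  -- each exponent is bounded through the mean of the rates by the Cauchy–Schwarz inequality
  have key : ∀ f : ℕ → ℕ, (∀ t < n, 0 < f t) →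
      Real.exp (-(c / 2 * ∑ t ∈ Finset.range n, 1 / (f t : ℝ)))
        ≤ 1 / 2 + Real.log 2 * ((∑ t ∈ Finset.range n, (f t : ℝ)) / (n * (M + 2)) - 1 / 2) := by
    intro f hf
    have hf' : ∀ t ∈ Finset.range n, (0 : ℝ) < f t := fun t ht => by
      exact_mod_cast hf t (Finset.mem_range.1 ht)
    have hX : 0 < ∑ t ∈ Finset.range n, (f t : ℝ) :=
      Finset.sum_pos hf' (Finset.nonempty_range_iff.2 hn0)
    have hcs : (n : ℝ) ^ 2 / ∑ t ∈ Finset.range n, (f t : ℝ)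
        ≤ ∑ t ∈ Finset.range n, 1 / (f t : ℝ) := by
      have := Finset.sq_sum_div_le_sum_sq_div (Finset.range n) (fun _ => (1 : ℝ)) hf'
      simpa using this
    refine le_trans (Real.exp_le_exp.2 ?_)
      (exp_neg_div_le (τ := c * n / (M + 2) / 2) (by positivity) (by linarith))
    have : c * n / (M + 2) / 2 / ((∑ t ∈ Finset.range n, (f t : ℝ)) / (n * (M + 2)))
        = c / 2 * ((n : ℝ) ^ 2 / ∑ t ∈ Finset.range n, (f t : ℝ)) := by
      field_simp
    rw [this]
    gcongr
  refine (add_le_add (key k fun t ht => (hkl t ht).1) (key l fun t ht => (hkl t ht).2.1)).trans ?_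
  have hsum : ∑ t ∈ Finset.range n, (l t : ℝ)
      = n * (M + 2) - ∑ t ∈ Finset.range n, (k t : ℝ) := by
    rw [eq_sub_iff_add_eq, ← Finset.sum_add_distrib]
    rw [Finset.sum_congr rfl fun t ht => ?_, Finset.sum_const, Finset.card_range, nsmul_eq_mul]
    have := (hkl t (Finset.mem_range.1 ht)).2.2
    rw [add_comm]
    exact_mod_cast this
  rw [hsum, sub_div, div_self (by positivity)]
  exact le_of_eq (by ring)

section WalkSurvival

variable {U : Type*} [Fintype U] {φ : ℕ → U → ℕ} {M : ℕ} {q N : ℝ}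

lemma energy_survival_succ_le (hφ : transfer φ = walkOp M q N) (hq : 1 ≤ q) (n : ℕ)
    (R : ℕ → Set ℕ) :
    energy M q (survival φ (n + 1) R)
      ≤ energy M q (walkOp M q N (survival φ n fun t => R (t + 1))) := by
  refine energy_mono (by linarith) fun i => ?_
  rw [← hφ]
  by_cases hi : i ∈ R 0 <;> simp [survival, hi]

lemma energy_survival_add_le (hφ : transfer φ = walkOp M q N) (hq : 1 ≤ q) (hN : 2 * q ≤ N)
    (t j : ℕ) (R : ℕ → Set ℕ) :
    energy M q (survival φ (t + j) R) ≤ energy M q (survival φ j fun s => R (s + t)) := by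
  induction t generalizing R with
  | zero => simp
  | succ t ih =>
    rw [Nat.add_right_comm]
    refine (energy_survival_succ_le hφ hq _ R).trans ((energy_walkOp_le_self hq hN _).trans ?_)
    exact (ih _).trans_eq (by simp only [Nat.add_assoc])

/-- The walk is invariant under the reflection of the interval `0, …, M + 1`. -/
lemma walkOp_reflect (a : ℕ → ℝ) (i : ℕ) :
    walkOp M q N a (M + 1 - i) = walkOp M q N (fun j => a (M + 1 - j)) i := by
  rcases Nat.eq_zero_or_pos i with rfl | hi
  · simp [walkOp]
  rcases Nat.lt_or_ge i (M + 1) with h | h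
  · have e1 : M + 1 - i ≠ 0 := by omega
    have e2 : ¬ M + 1 ≤ M + 1 - i := by omega
    have e3 : M + 1 - i - 1 = M + 1 - (i + 1) := by omega
    have e4 : M + 1 - i + 1 = M + 1 - (i - 1) := by omega
    rw [walkOp, walkOp, if_neg e1, if_neg e2, if_neg hi.ne', if_neg h.not_ge, e3, e4]
    ring
  · have e1 : M + 1 - i = 0 := by omega
    simp [walkOp, e1, h, hi.ne']

lemma survival_reflect (hφ : transfer φ = walkOp M q N) (n : ℕ) (R : ℕ → Set ℕ) (i : ℕ) :
    survival φ n R (M + 1 - i) = survival φ n (fun t => {j | M + 1 - j ∈ R t}) i := by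
  induction n generalizing R i with
  | zero => by_cases hi : M + 1 - i ∈ R 0 <;> simp [survival, hi]
  | succ n ih =>
    have : (fun j => survival φ n (fun t => R (t + 1)) (M + 1 - j))
        = survival φ n fun t => {j | M + 1 - j ∈ R (t + 1)} := funext fun j => ih _ j
    by_cases hi : M + 1 - i ∈ R 0 <;> simp [survival, hi, hφ, walkOp_reflect, this]

variable [Nonempty U]

lemma abs_survival_le_one (φ : ℕ → U → ℕ) (n : ℕ) (R : ℕ → Set ℕ) (i : ℕ) :
    |survival φ n R i| ≤ 1 :=
  abs_le.2 ⟨by linarith [show 0 ≤ survival φ n R i from survival_nonneg φ n R i],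
    survival_le_one φ n R i⟩

/-- The decay of the survival probability of the walk from `0` when, at time `t`, the site `k t` is
forbidden: the energy of the survival function decays at rate `1 / k t`. -/
lemma energy_survival_le (hφ : transfer φ = walkOp M q N) (hq : 1 ≤ q) (hN : 2 * q ≤ N)
    (n : ℕ) (R : ℕ → Set ℕ) (k : ℕ → ℕ) (hend : ∀ t ≤ n, M + 1 ∉ R t)
    (hk : ∀ t ≤ n, k t ≤ M + 1 ∧ 0 < k t ∧ k t ∉ R t) :
    energy M q (survival φ n R) ≤ M / q
      + Real.exp (-((2 - 4 * q / N) / N * ∑ t ∈ Finset.range n, 1 / (k (t + 1) : ℝ))) := by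
  induction n generalizing R k with
  | zero =>
    have := energy_le (M := M) (by linarith : 0 ≤ q) (abs_survival_le_one φ 0 R)
    rw [survival_eq_zero φ 0 (hend 0 le_rfl)] at this
    have h0 := sq_le_one_iff_abs_le_one _ |>.2 (abs_survival_le_one φ 0 R 0)
    simp only [Finset.range_zero, Finset.sum_empty, mul_zero, neg_zero, Real.exp_zero]
    linarith
  | succ n ih =>
    have h1 := ih (fun t => R (t + 1)) (fun t => k (t + 1)) (fun t ht => hend _ (by omega))
      fun t ht => hk _ (by omega)
    obtain ⟨hk1, hk2, hk3⟩ := hk 1 (by omega)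
    refine (energy_survival_succ_le hφ hq n R).trans ((energy_walkOp_le_exp hq hN
      (abs_survival_le_one φ n _) (survival_eq_zero φ n (hend 1 (by omega))) hk1 hk2
      (survival_eq_zero φ n hk3) h1).trans_eq ?_)
    rw [Finset.sum_range_succ' (fun t => 1 / (k (t + 1) : ℝ))]
    congr 2
    ring

/-- If the far end is forbidden at time `t` and the starting site `0` at time `t + 1`, then only
the small mass of the inner sites can survive. -/
lemma survival_le_of_notMem (hφ : transfer φ = walkOp M q N) (hq : 1 ≤ q) (hN : 2 * q ≤ N)
    {n t : ℕ} (ht : t + 1 ≤ n) {R : ℕ → Set ℕ} (hend : M + 1 ∉ R t) (h0 : 0 ∉ R (t + 1)) {s : ℝ}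
    (hs : M / q ≤ s ^ 2) (hs0 : 0 ≤ s) :
    survival φ n R 0 ≤ s + 1 / N := by
  have hN0 : 0 < N := by linarith
  obtain ⟨j, rfl⟩ := Nat.exists_eq_add_of_le ht
  have h1 : survival φ (t + (j + 1)) R 0 ^ 2 ≤ s ^ 2 + (1 / N) ^ 2 := by
    refine (sq_le_energy (M := M) (by linarith : 0 ≤ q) _).trans
      ((energy_survival_add_le hφ hq hN t (j + 1) R).trans
      ((energy_le (by linarith) (abs_survival_le_one φ _ _)).trans ?_))
    rw [survival_eq_zero φ (j + 1) (R := fun s => R (s + t)) (i := M + 1) (by simpa using hend)]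
    have h2 : survival φ (j + 1) (fun s => R (s + t)) 0 ≤ 1 / N := by
      have : survival φ j (fun s => R (s + 1 + t)) 0 = 0 :=
        survival_eq_zero φ j (by simpa [Nat.add_comm] using h0)
      refine (Set.indicator_le_self' (fun i _ => ?_) _).trans ?_
      · exact div_nonneg (Finset.sum_nonneg fun u _ => survival_nonneg _ _ _ _) (Nat.cast_nonneg _)
      · rw [hφ]
        simp only [walkOp, if_true, this, zero_add, sub_zero]
        gcongr
        exact survival_le_one φ j _ 1
    have h3 := pow_le_pow_left₀ (survival_nonneg φ (j + 1) (fun s => R (s + t)) 0) h2 2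
    linarith
  rw [show t + 1 + j = t + (j + 1) by ring]
  have h4 : 0 ≤ 1 / N := by positivity
  refine (abs_le_of_sq_le_sq' (h1.trans ?_) (by positivity)).2
  nlinarith

lemma survival_zero_le_exp (hφ : transfer φ = walkOp M q N) (hq : 1 ≤ q) (hN : 2 * q ≤ N)
    {n : ℕ} {R : ℕ → Set ℕ} {k : ℕ → ℕ} (hend : ∀ t ≤ n, M + 1 ∉ R t)
    (hk : ∀ t ≤ n, k t ≤ M + 1 ∧ 0 < k t ∧ k t ∉ R t) {s : ℝ} (hs : M / q ≤ s ^ 2) (hs0 : 0 ≤ s) :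
    survival φ n R 0
      ≤ s + Real.exp (-((2 - 4 * q / N) / N / 2 * ∑ t ∈ Finset.range n, 1 / (k (t + 1) : ℝ))) := by
  set A := (2 - 4 * q / N) / N * ∑ t ∈ Finset.range n, 1 / (k (t + 1) : ℝ) with hA
  have h1 := (sq_le_energy (M := M) (by linarith : 0 ≤ q) _).trans
    (energy_survival_le hφ hq hN n R k hend hk)
  have h2 : (2 - 4 * q / N) / N / 2 * ∑ t ∈ Finset.range n, 1 / (k (t + 1) : ℝ) = A / 2 := by
    rw [hA]; ring
  have h3 : Real.exp (-A) = Real.exp (-(A / 2)) ^ 2 := by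
    rw [sq, ← Real.exp_add]; ring_nf
  rw [h2]
  rw [← hA, h3] at h1
  have h4 := Real.exp_nonneg (-(A / 2))
  refine (abs_le_of_sq_le_sq' (h1.trans ?_) (by positivity)).2
  nlinarith

/-- The survival probabilities of the walk from `0` in `R` and from `M + 1` off `R` add up to
little more than one, for every time-dependent set `R`. -/
theorem survival_add_survival_compl_le (hφ : transfer φ = walkOp M q N) (hq : 1 ≤ q)
    (hN : 2 * q ≤ N) {n : ℕ} (hn : Real.log 2 ≤ (2 - 4 * q / N) / N * n / (M + 2)) {s : ℝ}
    (hs : M / q ≤ s ^ 2) (hsN : 1 / N ≤ s) (R : ℕ → Set ℕ) (h0 : 0 ∈ R 0) (hend : M + 1 ∉ R 0) :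
    survival φ n R 0 + survival φ n (fun t => (R t)ᶜ) (M + 1) ≤ 1 + 2 * s := by
  have hN0 : 0 < N := by linarith
  have hs0 : 0 ≤ s := le_trans (by positivity) hsN
  have hrefl := survival_reflect hφ n (fun t => (R t)ᶜ) 0
  rw [Nat.sub_zero] at hrefl
  rw [hrefl]
  by_cases hgood : ∀ t ≤ n, 0 ∈ R t ∧ M + 1 ∉ R t
  · -- the first site off `R t` is `k t`; by reflection, the first site of `R t`, as seen from the
    -- far end, is at distance at most `M + 2 - k t`
    have hex : ∀ t, ∃ k : ℕ, t ≤ n → k ≤ M + 1 ∧ 0 < k ∧ k ∉ R t ∧ k - 1 ∈ R t := by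
      classical
      intro t
      by_cases ht : t ≤ n
      · have hE : ∃ k, k ∉ R t := ⟨M + 1, (hgood t ht).2⟩
        have hpos : 0 < Nat.find hE :=
          (Nat.find_pos hE).2 (by simpa using (hgood t ht).1)
        exact ⟨Nat.find hE, fun _ => ⟨Nat.find_min' hE (hgood t ht).2, hpos, Nat.find_spec hE,
          by simpa using Nat.find_min hE (Nat.sub_lt hpos one_pos)⟩⟩
      · exact ⟨0, fun h => absurd h ht⟩
    choose k hk using hex
    have h1 := survival_zero_le_exp (k := k) hφ hq hN (fun t ht => (hgood t ht).2)
      (fun t ht => ⟨(hk t ht).1, (hk t ht).2.1, (hk t ht).2.2.1⟩) hs hs0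
    have h2 := survival_zero_le_exp (k := fun t => M + 2 - k t)
      (R := fun t => {j | M + 1 - j ∈ (R t)ᶜ}) hφ hq hN
      (fun t ht => by simpa using (hgood t ht).1)
      (fun t ht => by
        obtain ⟨e1, e2, -, e4⟩ := hk t ht
        refine ⟨by omega, by omega, ?_⟩
        have : M + 1 - (M + 2 - k t) = k t - 1 := by omega
        simpa [this] using e4) hs hs0
    have hc : 0 ≤ (2 - 4 * q / N) / N := by
      have : 4 * q / N ≤ 2 := by rw [div_le_iff₀ hN0]; linarith
      exact div_nonneg (by linarith) hN0.le
    have h3 := exp_add_exp_le_one hc (fun t => k (t + 1)) (fun t => M + 2 - k (t + 1))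
      (fun t ht => by
        obtain ⟨e1, e2, -, -⟩ := hk (t + 1) (by omega)
        omega) hn
    linarith
  · classical
    have hbad : ∃ t, t ≤ n ∧ ¬ (0 ∈ R t ∧ M + 1 ∉ R t) := by simpa using hgood
    obtain ⟨t, ht⟩ : ∃ t, Nat.find hbad = t + 1 := Nat.exists_eq_succ_of_ne_zero fun h => by
      have := Nat.find_spec hbad
      rw [h] at this
      exact this.2 ⟨h0, hend⟩
    obtain ⟨htn, hspec⟩ := Nat.find_spec hbad
    rw [ht] at htn hspec
    have hprev : 0 ∈ R t ∧ M + 1 ∉ R t := by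
      by_contra hc
      exact Nat.find_min hbad (m := t) (by omega) ⟨by omega, hc⟩
    have hle1 := survival_le_one φ n R 0
    have hle2 := survival_le_one φ n (fun t => {j | M + 1 - j ∈ (R t)ᶜ}) 0
    simp only [Pi.one_apply] at hle1 hle2
    by_cases h0' : 0 ∈ R (t + 1)
    · have hend' : M + 1 ∈ R (t + 1) := by tauto
      have := survival_le_of_notMem (R := fun t => {j | M + 1 - j ∈ (R t)ᶜ}) hφ hq hN htn
        (by simpa using hprev.1) (by simpa using hend') hs hs0
      linarith
    · have := survival_le_of_notMem hφ hq hN htn hprev.2 h0' hs hs0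
      linarith

end WalkSurvival

/-! ### The distance between the two ends of the walk -/

section WalkDistance

variable {S U : Type*} [Fintype U]

lemma iterate_transfer_smul_add_smul (φ : S → U → S) (x y : ℝ) (a b : S → ℝ) (n : ℕ) :
    (transfer φ)^[n] (x • a + y • b) = x • (transfer φ)^[n] a + y • (transfer φ)^[n] b := by
  induction n generalizing a b with
  | zero => rfl
  | succ n ih =>
    rw [Function.iterate_succ_apply, transfer_add, transfer_smul, transfer_smul, ih]
    rfl

/-- If `b` is an approximate eigenfunction with eigenvalue `l`, up to the error `κ • c`, then its
iterates are at least `l ^ n • b`, up to the accumulated errors. -/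
lemma pow_mul_sub_le_iterate_transfer (φ : S → U → S) {l κ : ℝ} (hl0 : 0 ≤ l) (hl1 : l ≤ 1)
    (hκ : 0 ≤ κ) {b c : S → ℝ} (hc : 0 ≤ c) (hb : ∀ i, l * b i - κ * c i ≤ transfer φ b i)
    {i : S} {s : ℝ} (hs : ∀ n, (transfer φ)^[n] c i ≤ s) (n : ℕ) :
    l ^ n * b i - κ * n * s ≤ (transfer φ)^[n] b i := by
  have hmono : Monotone (transfer φ) := fun _ _ h => transfer_mono φ h
  have hs0 : 0 ≤ s := (hc i).trans (hs 0)
  induction n with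
  | zero => simp
  | succ n ih =>
    have h1 : l • b + (-κ) • c ≤ transfer φ b := fun j => by
      have := hb j
      simp only [Pi.add_apply, Pi.smul_apply, smul_eq_mul]
      linarith
    have h2 := hmono.iterate n h1 i
    rw [iterate_transfer_smul_add_smul] at h2
    simp only [Pi.add_apply, Pi.smul_apply, smul_eq_mul] at h2
    rw [Function.iterate_succ_apply]
    have h3 := mul_le_mul_of_nonneg_left ih hl0
    have h4 := mul_le_mul_of_nonneg_left (hs n) hκ
    have h5 : l * (κ * n * s) ≤ κ * n * s := mul_le_of_le_one_left (by positivity) hl1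
    push_cast
    rw [pow_succ]
    linarith

/-- The function that decreases linearly from `1 / 2` to `-1 / 2` along the sites `0, …, M + 1`. -/
noncomputable def linearProfile (M i : ℕ) : ℝ := 1 / 2 - (min i (M + 1) : ℕ) / (M + 1)

lemma abs_linearProfile_le (M i : ℕ) : |linearProfile M i| ≤ 1 / 2 := by
  have h1 : ((min i (M + 1) : ℕ) : ℝ) ≤ M + 1 := by exact_mod_cast min_le_right i (M + 1)
  have h2 : ((min i (M + 1) : ℕ) : ℝ) / (M + 1) ≤ 1 := div_le_one_of_le₀ h1 (by positivity)
  have h3 : 0 ≤ ((min i (M + 1) : ℕ) : ℝ) / (M + 1) := by positivity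
  rw [abs_le, linearProfile]
  constructor <;> linarith

/-- The indicator of the inner sites. -/
def innerIndicator (M i : ℕ) : ℝ := if i = 0 ∨ M + 1 ≤ i then 0 else 1

lemma walkOp_linearProfile (M : ℕ) (q N : ℝ) (i : ℕ) :
    |walkOp M q N (linearProfile M) i - (1 - 2 / (N * (M + 1))) * linearProfile M i|
      ≤ |2 / (N * (M + 1))| * (1 / 2) * innerIndicator M i := by
  have hM : (M : ℝ) + 1 ≠ 0 := by positivity
  rcases Nat.eq_zero_or_pos i with rfl | hi
  · simp only [walkOp, linearProfile, innerIndicator]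
    norm_num
    field_simp
    ring
  rcases Nat.lt_or_ge i (M + 1) with h | h
  · have e1 : ((i - 1 : ℕ) : ℝ) = i - 1 := by rw [Nat.cast_sub hi]; simp
    have e2 : walkOp M q N (linearProfile M) i = linearProfile M i := by
      rw [walkOp, if_neg hi.ne', if_neg h.not_ge]
      simp only [linearProfile, min_eq_left h.le, min_eq_left (show i - 1 ≤ M + 1 by omega),
        min_eq_left (show i + 1 ≤ M + 1 by omega), e1]
      push_cast
      ring
    have e3 : linearProfile M i - (1 - 2 / (N * (M + 1))) * linearProfile M i
        = 2 / (N * (M + 1)) * linearProfile M i := by ring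
    have e4 : innerIndicator M i = 1 := if_neg (by omega)
    rw [e2, e3, abs_mul, e4, mul_one]
    exact mul_le_mul_of_nonneg_left (abs_linearProfile_le M i) (abs_nonneg _)
  · have e2 : linearProfile M i = -1 / 2 := by
      rw [linearProfile, min_eq_right h]
      push_cast
      field_simp
      norm_num
    have e3 : walkOp M q N (linearProfile M) i = -1 / 2 + 1 / (N * (M + 1)) := by
      rw [walkOp, if_neg hi.ne', if_pos h]
      simp only [linearProfile, min_eq_right le_rfl, min_eq_left (Nat.le_succ M)]
      push_cast
      field_simp
      ring
    have e4 : innerIndicator M i = 0 := if_pos (Or.inr h)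
    rw [e2, e3, e4, mul_zero]
    exact le_of_eq (abs_eq_zero.2 (by ring))

/-- The expectations of the linear profile after `n` steps of the walk, started at its two ends,
differ by almost as much as for a two-state chain that switches with probability
`1 / (N * (M + 1))`. -/
lemma le_iterate_transfer_linearProfile {φ : ℕ → U → ℕ} {M : ℕ} {q N : ℝ}
    (hφ : transfer φ = walkOp M q N) (hq : 1 ≤ q) (hN : 2 * q ≤ N) {s : ℝ}
    (hs : M / q ≤ s ^ 2) (hs0 : 0 ≤ s) (n : ℕ) :
    (1 - 2 / (N * (M + 1))) ^ n - 2 / (N * (M + 1)) * n * s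
      ≤ (transfer φ)^[n] (linearProfile M) 0 - (transfer φ)^[n] (linearProfile M) (M + 1) := by
  have hN0 : 0 < N := by linarith
  set κ := 2 / (N * (M + 1)) with hκ
  have hκ0 : 0 < κ := by positivity
  have hκ1 : κ ≤ 1 := by
    rw [hκ, div_le_one (by positivity)]
    have : (0 : ℝ) ≤ M := Nat.cast_nonneg M
    nlinarith
  have hc : (0 : ℕ → ℝ) ≤ innerIndicator M := fun i => by
    simp only [innerIndicator, Pi.zero_apply]
    split_ifs <;> norm_num
  have hen : ∀ k, energy M q ((transfer φ)^[k] (innerIndicator M)) ≤ s ^ 2 := by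
    intro k
    induction k with
    | zero =>
      refine (energy_le (by linarith) fun i => ?_).trans (le_trans (le_of_eq ?_) hs)
      · simp only [Function.iterate_zero, id_eq, innerIndicator]
        split_ifs <;> norm_num
      · simp [innerIndicator]
    | succ k ih =>
      rw [Function.iterate_succ_apply', hφ]
      rw [hφ] at ih
      exact (energy_walkOp_le_self hq hN _).trans ih
  have hs1 : ∀ k, (transfer φ)^[k] (innerIndicator M) 0 ≤ s := fun k =>
    (abs_le_of_sq_le_sq' ((sq_le_energy (by linarith) _).trans (hen k)) hs0).2
  have hs2 : ∀ k, (transfer φ)^[k] (innerIndicator M) (M + 1) ≤ s := fun k =>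
    (abs_le_of_sq_le_sq' ((sq_end_le_energy (by linarith) _).trans (hen k)) hs0).2
  have happrox := fun i => abs_le.1 (walkOp_linearProfile M q N i)
  rw [← hκ, abs_of_pos hκ0] at happrox
  have h1 := pow_mul_sub_le_iterate_transfer φ (sub_nonneg.2 hκ1) (by linarith)
    (by positivity : 0 ≤ κ * (1 / 2)) hc (b := linearProfile M)
    (fun i => by rw [hφ]; linarith [(happrox i).1]) hs1 n
  have h2 := pow_mul_sub_le_iterate_transfer φ (sub_nonneg.2 hκ1) (by linarith)
    (by positivity : 0 ≤ κ * (1 / 2)) hc (b := (-1 : ℝ) • linearProfile M)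
    (fun i => by
      rw [transfer_smul, hφ]
      simp only [Pi.smul_apply, smul_eq_mul]
      linarith [(happrox i).2]) hs2 n
  have h3 := congrFun (iterate_transfer_smul_add_smul φ (-1) 0 (linearProfile M) 0 n) (M + 1)
  simp only [smul_zero, add_zero, zero_smul, Pi.smul_apply, smul_eq_mul] at h3
  rw [h3] at h2
  have e1 : linearProfile M 0 = 1 / 2 := by simp [linearProfile]
  have e2 : linearProfile M (M + 1) = -1 / 2 := by
    simp only [linearProfile, min_self]
    push_cast
    field_simp
    norm_num
  simp only [Pi.smul_apply, smul_eq_mul, e2] at h2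
  rw [e1] at h1
  linarith

end WalkDistance

/-! ### The walk as a driven chain -/

section SiteStep

/-- The update map of the walk: an inner site moves to the left or to the right when the driving
variable lies in the first or second summand, and an end is left for one value only. -/
def siteStep (M : ℕ) {q r : ℕ} (i : ℕ) (u : Fin q ⊕ Fin q ⊕ Fin r) : ℕ :=
  if i = 0 then Sum.elim (fun j : Fin q => if (j : ℕ) = 0 then 1 else 0) (fun _ => 0) u
  else if M + 1 ≤ i then
    Sum.elim (fun j : Fin q => if (j : ℕ) = 0 then M else M + 1) (fun _ => M + 1) u
  else Sum.elim (fun _ => i - 1) (Sum.elim (fun _ => i + 1) fun _ => i) u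

lemma sum_fin_ite_eq_zero {q : ℕ} (hq : 0 < q) (x y : ℝ) :
    ∑ j : Fin q, (if (j : ℕ) = 0 then x else y) = q * y + (x - y) := by
  obtain ⟨q, rfl⟩ := Nat.exists_eq_succ_of_ne_zero hq.ne'
  rw [Fin.sum_univ_succ]
  simp
  ring

lemma transfer_siteStep (M : ℕ) {q r : ℕ} (hq : 0 < q) :
    transfer (siteStep M (q := q) (r := r)) = walkOp M q (2 * q + r) := by
  ext a i
  have hN : (2 * q + r : ℝ) ≠ 0 := by positivity
  have hcard : (Fintype.card (Fin q ⊕ Fin q ⊕ Fin r) : ℝ) = 2 * q + r := by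
    simp only [Fintype.card_sum, Fintype.card_fin]
    push_cast
    ring
  rw [transfer, hcard, Fintype.sum_sum_type, Fintype.sum_sum_type, walkOp]
  simp only [siteStep]
  split_ifs with h0 h1
  · simp only [Sum.elim_inl, Sum.elim_inr, apply_ite a, sum_fin_ite_eq_zero hq, Finset.sum_const,
      Finset.card_univ, Fintype.card_fin, nsmul_eq_mul]
    field_simp
    ring
  · simp only [Sum.elim_inl, Sum.elim_inr, apply_ite a, sum_fin_ite_eq_zero hq, Finset.sum_const,
      Finset.card_univ, Fintype.card_fin, nsmul_eq_mul]
    field_simp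
    ring
  · simp only [Sum.elim_inl, Sum.elim_inr, Finset.sum_const, Finset.card_univ, Fintype.card_fin,
      nsmul_eq_mul]
    field_simp
    ring

/-- The projection of `ℕ` onto the sites `0, …, M + 1`. -/
def clampSite (M i : ℕ) : Fin (M + 2) := ⟨min i (M + 1), by omega⟩

lemma clampSite_siteStep (M : ℕ) {q r : ℕ} (i : ℕ) (u : Fin q ⊕ Fin q ⊕ Fin r) :
    clampSite M (siteStep M i u) = clampSite M (siteStep M (clampSite M i : ℕ) u) := by
  rcases le_total i (M + 1) with h | h
  · rw [show ((clampSite M i : Fin (M + 2)) : ℕ) = i from min_eq_left h]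
  · rw [show ((clampSite M i : Fin (M + 2)) : ℕ) = M + 1 from min_eq_right h]
    simp [siteStep, h, show i ≠ 0 by omega]

end SiteStep

/-! ### The limit of long intervals -/

open Filter Topology in
/-- The choice of the length `M` of the interval: `z` bounds the expected number of switches times
two, which tends to `log 2`, and the last expression bounds the distance of the laws from below. -/
lemma exists_large_interval {ε : ℝ} (hε : 0 < ε) :
    ∃ M : ℕ, 4 ≤ M ∧ ∀ x : ℝ, x = 1 / M → ∀ z : ℝ,
      z = Real.log 2 * (1 + 2 * x) / ((1 - 2 * x) * (1 + x)) + x →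
      1 / 2 - ε ≤ (1 - 4 * x) * (Real.exp (-(z / (1 - x))) - z * (x / 2)) := by
  set Z : ℝ → ℝ := fun x => Real.log 2 * (1 + 2 * x) / ((1 - 2 * x) * (1 + x)) + x with hZ
  set F : ℝ → ℝ := fun x => (1 - 4 * x) * (Real.exp (-(Z x / (1 - x))) - Z x * (x / 2)) with hF
  have hZc : ContinuousAt Z 0 := by
    exact (ContinuousAt.div (by fun_prop) (by fun_prop) (by norm_num)).add (by fun_prop)
  have hFc : ContinuousAt F 0 := by
    have : ContinuousAt (fun x => Z x / (1 - x)) 0 :=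
      hZc.div (by fun_prop) (by norm_num)
    fun_prop
  have hF0 : F 0 = 1 / 2 := by
    simp [hF, hZ, Real.exp_neg, Real.exp_log]
  have hev : ∀ᶠ x in 𝓝 (0 : ℝ), 1 / 2 - ε < F x :=
    hFc.eventually_const_lt (by rw [hF0]; linarith)
  obtain ⟨M, hM4, hM⟩ := ((eventually_ge_atTop 4).and
    (tendsto_one_div_atTop_nhds_zero_nat.eventually hev)).exists
  refine ⟨M, hM4, ?_⟩
  rintro _ rfl _ rfl
  exact hM.le

theorem mainTheorem2 (ε : ℝ) (hε : 0 < ε) :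
    ∃ (S : Type) (_ : Fintype S) (_ : DecidableEq S) (P : Matrix S S ℝ) (x y : S) (T : ℕ),
      P ∈ Matrix.rowStochastic ℝ S ∧ 0 < T ∧
      1 / 2 - ε ≤ tvDist ((P ^ T) x) ((P ^ T) y) ∧
      ∃ (Ω : Type) (_ : MeasurableSpace Ω) (μ : Measure Ω) (X Y : Fin (T + 1) → Ω → S),
        IsProbabilityMeasure μ ∧ IsCoupling μ P x y X Y ∧
        μ {ω | ∃ t, X t ω = Y t ω} = 1 := by
  obtain ⟨M, hM4, hM⟩ := exists_large_interval hε
  have hMr : (4 : ℝ) ≤ M := by exact_mod_cast hM4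
  have hM0 : (0 : ℝ) < M := by linarith
  -- inner sites carry the small total mass `M / q = s ^ 2`, and `c` is the energy decay rate
  obtain ⟨q, hq⟩ : ∃ q : ℕ, q = 4 * M ^ 3 := ⟨_, rfl⟩
  obtain ⟨r, hr⟩ : ∃ r : ℕ, 2 * q + r = 4 * M ^ 4 := by
    refine ⟨4 * M ^ 4 - 2 * q, Nat.add_sub_cancel' ?_⟩
    rw [hq, pow_succ M 3]
    nlinarith [pow_pos (by omega : 0 < M) 3]
  have hqr : (q : ℝ) = 4 * M ^ 3 := by rw [hq]; push_cast; ring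
  have hNr : (2 * q + r : ℝ) = 4 * M ^ 4 := by exact_mod_cast hr
  have hq0 : 0 < q := by rw [hq]; positivity
  have : NeZero q := ⟨hq0.ne'⟩
  set N : ℝ := 2 * q + r with hN
  have hN0 : 0 < N := by rw [hNr]; positivity
  have hq1 : (1 : ℝ) ≤ q := by exact_mod_cast hq0
  have hqN : 2 * (q : ℝ) ≤ N := by rw [hN]; simp
  set s : ℝ := 1 / (2 * M) with hs
  have hs0 : 0 ≤ s := by positivity
  have hsq : (M : ℝ) / q ≤ s ^ 2 := by
    rw [hqr, hs]
    refine le_of_eq ?_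
    field_simp
    norm_num
  have hsN : 1 / N ≤ s := by
    rw [hNr, hs]
    have : (M : ℝ) ≤ (M : ℝ) ^ 4 := le_self_pow₀ (by linarith) (by norm_num)
    exact one_div_le_one_div_of_le (by positivity) (by linarith)
  set c : ℝ := (2 - 4 * q / N) / N with hc
  have hc' : c = (1 - 2 / M) * (2 / N) := by
    have : 4 * (q : ℝ) / N = 4 / M := by rw [hqr, hNr]; field_simp
    rw [hc, this]
    ring
  have hx2 : 2 / (M : ℝ) ≤ 1 / 2 := by rw [div_le_iff₀ hM0]; linarith
  have hc0 : 0 < c := by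
    rw [hc']
    exact mul_pos (by linarith) (by positivity)
  -- the number of steps after which the survival probabilities drop to one half
  obtain ⟨n, hn⟩ : ∃ n : ℕ, n = ⌈Real.log 2 * (M + 2) / c⌉₊ := ⟨_, rfl⟩
  have hn1 : Real.log 2 ≤ c * n / (M + 2) := by
    have := Nat.le_ceil (Real.log 2 * (M + 2) / c)
    rw [← hn, div_le_iff₀ hc0] at this
    rw [le_div_iff₀ (by positivity)]
    linarith
  have hn2 : (n : ℝ) ≤ Real.log 2 * (M + 2) / c + 1 := by
    rw [hn]
    refine (Nat.ceil_lt_add_one ?_).le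
    have := Real.log_pos one_lt_two
    positivity
  have hφ := transfer_siteStep M (r := r) hq0
  rw [← hN] at hφ
  -- transport from the walk on `ℕ` to the finite state space
  let ψ : Fin (M + 2) → Fin q ⊕ Fin q ⊕ Fin r → Fin (M + 2) :=
    fun i u => clampSite M (siteStep M (i : ℕ) u)
  have hψ : ∀ i u, clampSite M (siteStep M i u) = ψ (clampSite M i) u :=
    fun i u => clampSite_siteStep M i u
  let D : Fin q ⊕ Fin q ⊕ Fin r → Bool :=
    Sum.elim (fun _ => true) (Sum.elim (fun _ => true) fun _ => false)
  have hD : swapProb D = 2 / M := by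
    have hcard : (Fintype.card (Fin q ⊕ Fin q ⊕ Fin r) : ℝ) = N := by
      simp only [Fintype.card_sum, Fintype.card_fin, hN]
      push_cast
      ring
    rw [swapProb, hcard, Fintype.sum_sum_type, Fintype.sum_sum_type]
    simp [D]
    rw [hqr, hNr]
    field_simp
    ring
  refine exists_coupling_of_survival ψ (clampSite M 0) (clampSite M (M + 1)) D (e := 2 * s) (n := n)
    ?_ ?_ ?_ (fun i => linearProfile M i) (fun i => abs_linearProfile_le M i) ?_
  · rw [hD, hs]
    have : 2 * (1 / (2 * (M : ℝ))) = 1 / M := by field_simp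
    rw [this]
    gcongr
    norm_num
  · rw [hD]
    exact hx2
  · intro R h0 hend
    rw [survival_semiconj hψ, survival_semiconj hψ]
    exact survival_add_survival_compl_le hφ hq1 hqN hn1 hsq hsN _ h0 hend
  · have hprof : (fun i : Fin (M + 2) => linearProfile M i) ∘ clampSite M = linearProfile M := by
      ext j
      simp [linearProfile, clampSite]
    rw [iterate_transfer_semiconj hψ, iterate_transfer_semiconj hψ, hprof, hD]
    have hdist := le_iterate_transfer_linearProfile hφ hq1 hqN hsq hs0 n
    set κ : ℝ := 2 / (N * (M + 1)) with hκ
    set x : ℝ := 1 / M with hx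
    obtain ⟨z, hz⟩ : ∃ z : ℝ,
      z = Real.log 2 * (1 + 2 * x) / ((1 - 2 * x) * (1 + x)) + x := ⟨_, rfl⟩
    have hx0 : 0 < x := by positivity
    have hx1 : x ≤ 1 / 4 := by rw [hx]; gcongr
    have hκ0 : 0 < κ := by positivity
    have hκx : κ ≤ x := by
      rw [hκ, hx, div_le_div_iff₀ (by positivity) hM0, hNr]
      nlinarith [pow_le_pow_left₀ (by norm_num) hMr 4]
    have hnκ : κ * n ≤ z := by
      have h1 : κ * n ≤ κ * (Real.log 2 * (M + 2) / c + 1) := by gcongr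
      have h2 : κ * (Real.log 2 * (M + 2) / c)
          = Real.log 2 * (1 + 2 * x) / ((1 - 2 * x) * (1 + x)) := by
        have : (1 - 2 / (M : ℝ)) ≠ 0 := by linarith
        have : (M : ℝ) - 2 ≠ 0 := by linarith
        rw [hκ, hc', hx]
        field_simp
      rw [hz]
      linarith
    have hpow : Real.exp (-(z / (1 - x))) ≤ (1 - κ) ^ n := by
      have h1 : 0 < 1 - κ := by linarith
      rw [← Real.log_le_log_iff (Real.exp_pos _) (pow_pos h1 n), Real.log_exp, Real.log_pow]
      have h2 := Real.one_sub_inv_le_log_of_pos h1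
      have h3 : 1 - (1 - κ)⁻¹ = -(κ / (1 - κ)) := by field_simp; ring
      rw [h3] at h2
      have h4 : (n : ℝ) * -(κ / (1 - κ)) ≤ n * Real.log (1 - κ) := by gcongr
      have h5 : κ * n / (1 - κ) ≤ z / (1 - x) := by
        have : 0 ≤ κ * n := by positivity
        exact div_le_div₀ (this.trans hnκ) hnκ (by linarith) (by linarith)
      have h6 : (n : ℝ) * -(κ / (1 - κ)) = -(κ * n / (1 - κ)) := by ring
      linarith
    have hsx : s = x / 2 := by rw [hs, hx]; field_simp
    refine (hM x rfl z hz).trans ?_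
    have h1 : 1 - 2 * (2 / (M : ℝ)) = 1 - 4 * x := by rw [hx]; ring
    rw [h1]
    refine mul_le_mul_of_nonneg_left (le_trans ?_ hdist) (by linarith)
    rw [← hsx]
    have h2 : κ * n * s ≤ z * s := by gcongr
    linarith
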